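/- For $k\in\mathbb{N}_0$ and $\lambda>0$ let $$C_k^{\lambda}(x)=\frac{1}{\sqrt{\lambda^k\,k!}}\sum_{\ell=0}^{k}\binom{k}{\ell}(-\lambda)^{k-\ell}\,x(x-1)\cdots(x-\ell+1)$$ be the normalized Poisson–Charlier polynomial of order $k$, so that in particular $C_2^{\lambda}(x)=\dfrac{x^2-(2\lambda+1)x+\lambda^2}{\sqrt{2}\,\lambda}$. Let $\mathrm{Po}(\lambda)$ be the Poisson distribution with mean $\lambda$, and let $D(X\Vert \mathrm{Po}(\lambda))\in[0,\infty]$ be the information divergence (Kullback–Leibler divergence, with natural logarithm) of the distribution of $X$ from $\mathrm{Po}(\lambda)$. **Theorem.** Let $X$ be a random variable with values in $\mathbb{N}_0$ and let $\lambda>0$. If $\mathrm{E}[C_2^{\lambda}(X)]\le 0$, then $$D\bigl(X\,\Vert\,\mathrm{Po}(\lambda)\bigr)\ \ge\ \frac{\mathrm{E}\bigl[C_2^{\lambda}(X)\bigr]^2}{2}.$$ No assumption is made on the mean of $X$. -/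

import Mathlib

/-- The normalized Poisson-Charlier polynomial of order `k` with parameter `lam`,
`(lam ^ k * k!) ^ (-1/2) * ∑ ℓ = 0..k, (k choose ℓ) * (-lam) ^ (k - ℓ) * x (x - 1) ⋯ (x - ℓ + 1)`,
as a function of the real variable `x`. The exponent `k - ℓ` is never truncated since `ℓ ≤ k`. -/
noncomputable def poissonCharlier (lam : ℝ) (k : ℕ) (x : ℝ) : ℝ :=
  (lam ^ k * (Nat.factorial k : ℝ)) ^ (-(1 / 2) : ℝ) *
    ∑ l ∈ Finset.range (k + 1),
      (Nat.choose k l : ℝ) * (-lam) ^ (k - l) * (descPochhammer ℝ l).eval x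

/-!
Write `c` for the second Poisson–Charlier moment. The easy half of the Donsker–Varadhan formula,
applied to the function `c * poissonCharlier lam 2`, bounds the divergence below by
`c ^ 2 - log (E exp (c * C₂))`, the expectation being under the Poisson distribution. Since
`c ≤ 0`, it suffices that `E exp (-s * C₂)` is at most the Gaussian value `exp (s ^ 2 / 2)` for
every `s ≥ 0` (`integral_exp_neg_mul_poissonCharlier_two_le`).

With `s = b * lam / √2` and `q = exp (-b)`, expanding the exponent shows that this expectation is
`exp (-lam - b * lam ^ 2 / 2) * G (lam * exp (b * lam))`, where
`G x = ∑ k, q ^ (k.choose 2) * x ^ k / k!` is the deformed exponential, the solution of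
`G' x = G (q * x)`, `G 0 = 1`. The claim becomes `G (l * exp (b * l)) ≤ exp (h l)` with
`h l = l + b * l ^ 2 / 2 + b ^ 2 * l ^ 2 / 4`. It follows by comparison
(`deformedExpSum_le_exp`), carried out on the partial sums of `G`, once the right side is known to
be a supersolution of the same equation (`exp_deformedExponent_supersolution`). In the variable `l`,
the dilated point `q * x` corresponds to some `l - d`, for which a rational lower bound of `d`
suffices because `G` is increasing; with `2 * z / (z + 2) ≤ log (1 + z)` the supersolution property
becomes the nonnegativity of a polynomial in `b` and `l`.
-/

open MeasureTheory ProbabilityTheory InformationTheory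
open scoped Nat

/-! ### The deformed exponential -/

/-- The truncation to `N` terms of the deformed exponential series
`∑ k, q ^ (k.choose 2) * x ^ k / k!` with `q = exp (-b)`. -/
noncomputable def deformedExpSum (b : ℝ) (N : ℕ) (x : ℝ) : ℝ :=
  ∑ k ∈ Finset.range N, Real.exp (-(b * (k.choose 2 : ℕ))) * x ^ k / (k ! : ℝ)

lemma deformedExpSum_mono (b : ℝ) (N : ℕ) {x y : ℝ} (hx : 0 ≤ x) (hxy : x ≤ y) :
    deformedExpSum b N x ≤ deformedExpSum b N y := by
  unfold deformedExpSum
  gcongr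

lemma deformedExpSum_zero_right (b : ℝ) (N : ℕ) : deformedExpSum b (N + 1) 0 = 1 := by
  simp [deformedExpSum, Finset.sum_range_succ']

/-- The pantograph equation `G' x = G (q * x)`: differentiating a truncation drops one term and
dilates the variable. -/
lemma hasDerivAt_deformedExpSum (b : ℝ) (N : ℕ) (x : ℝ) :
    HasDerivAt (deformedExpSum b (N + 1)) (deformedExpSum b N (Real.exp (-b) * x)) x := by
  have hterm : ∀ k ∈ Finset.range (N + 1), HasDerivAt
      (fun y : ℝ ↦ Real.exp (-(b * (k.choose 2 : ℕ))) * y ^ k / (k ! : ℝ))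
      (Real.exp (-(b * (k.choose 2 : ℕ))) * (k * x ^ (k - 1)) / (k ! : ℝ)) x :=
    fun k _ ↦ ((hasDerivAt_pow k x).const_mul _).div_const _
  have hsum := HasDerivAt.fun_sum hterm
  convert! hsum using 1
  rw [Finset.sum_range_succ', deformedExpSum]
  simp only [Nat.cast_zero, zero_mul, mul_zero, zero_div, add_zero]
  refine Finset.sum_congr rfl fun k _ ↦ ?_
  have hchoose : (((k + 1).choose 2 : ℕ) : ℝ) = k + (k.choose 2 : ℕ) := by
    rw [Nat.choose_succ_succ' k 1, Nat.choose_one_right, Nat.cast_add]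
  have hexp : Real.exp (-(b * (k + (k.choose 2 : ℕ)))) =
      Real.exp (-(b * (k.choose 2 : ℕ))) * Real.exp (-b) ^ k := by
    rw [← Real.exp_nat_mul, ← Real.exp_add]
    ring_nf
  have hk : ((k : ℝ) + 1) ≠ 0 := by positivity
  have hfac : (k ! : ℝ) ≠ 0 := by positivity
  rw [hchoose, hexp, Nat.factorial_succ, mul_pow, Nat.add_sub_cancel]
  push_cast
  field_simp

/-! ### A supersolution of the pantograph equation -/

/-- The polynomial to which `deformed_exponent_gap` reduces after clearing denominators. -/
lemma gap_polynomial_nonneg {b l : ℝ} (hb : 0 ≤ b) (hl : 0 ≤ l) :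
    0 ≤ (1 - 3 / 2 * l + 2 * l ^ 2) + b * (1 - l / 2 + l ^ 2 / 2 + 2 * l ^ 3)
      + b ^ 2 * (1 / 2 - l / 2 - l ^ 2 / 4 + 5 / 2 * l ^ 3)
      + b ^ 3 * (-l / 4 + l ^ 2 / 8 + l ^ 3) + b ^ 4 * (l ^ 2 / 16 + l ^ 3 / 8) := by
  have h0 : 0 ≤ 1 - 3 / 2 * l + 2 * l ^ 2 := by nlinarith [sq_nonneg (l - 3 / 8)]
  have h1 : 0 ≤ 1 - l / 2 + l ^ 2 / 2 + 2 * l ^ 3 := by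
    nlinarith [sq_nonneg (l - 1 / 2), pow_nonneg hl 3]
  have h2 : 0 ≤ 1 / 4 - l / 2 - l ^ 2 / 4 + 5 / 2 * l ^ 3 := by
    nlinarith [mul_nonneg hl (sq_nonneg (l - 1 / 3)), sq_nonneg (l - 1 / 3)]
  -- The term `-b ^ 3 * l / 4` is absorbed by completing a square in `b * l`.
  have hsq : 0 ≤ b ^ 2 * (b * l / 4 - 1 / 2) ^ 2 := by positivity
  have h3 : 0 ≤ b ^ 3 * (l ^ 2 / 8 + l ^ 3) + b ^ 4 * (l ^ 3 / 8) := by positivity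
  nlinarith [mul_nonneg hb h1, mul_nonneg (sq_nonneg b) h2]

/-- The length of the backward step: if `d = deformedStep b l` then
`exp (-b) * (l * exp (b * l)) ≤ (l - d) * exp (b * (l - d))`. It is `l * E / (1 + l * E)` for
`E = 1 - 1 / (1 + b + b ^ 2 / 2)`, a rational lower bound of `1 - exp (-b)`. -/
noncomputable def deformedStep (b l : ℝ) : ℝ :=
  l * (b + b ^ 2 / 2) / (1 + b + b ^ 2 / 2 + l * (b + b ^ 2 / 2))

lemma deformedStep_le {b l : ℝ} (hb : 0 ≤ b) (hl : 0 ≤ l) : deformedStep b l ≤ l := by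
  unfold deformedStep
  rw [div_le_iff₀ (by positivity)]
  have : 0 ≤ l * (l * (b + b ^ 2 / 2)) := by positivity
  nlinarith

lemma exp_neg_mul_le_of_deformedStep {b l : ℝ} (hb : 0 ≤ b) (hl : 0 ≤ l) :
    Real.exp (-b) * (l * Real.exp (b * l)) ≤
      (l - deformedStep b l) * Real.exp (b * (l - deformedStep b l)) := by
  set d := deformedStep b l with hd
  have hden : 0 < 1 + b + b ^ 2 / 2 + l * (b + b ^ 2 / 2) := by positivity
  have hd0 : 0 ≤ d := by rw [hd, deformedStep]; positivity
  have hd1 : d ≤ 1 := by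
    rw [hd, deformedStep, div_le_one hden]
    nlinarith [sq_nonneg b]
  -- Convexity of the exponential along the chord from `-b` to `0`.
  have hchord : Real.exp (-(b * (1 - d))) ≤ (1 - d) * Real.exp (-b) + d := by
    have := convexOn_exp.2 (Set.mem_univ (-b)) (Set.mem_univ 0) (sub_nonneg.2 hd1) hd0 (by ring)
    simp only [smul_eq_mul, mul_zero, add_zero, Real.exp_zero, mul_one] at this
    convert! this using 2
    ring
  have hexp : Real.exp (-b) ≤ 1 / (1 + b + b ^ 2 / 2) := by
    rw [Real.exp_neg, ← one_div]
    exact one_div_le_one_div_of_le (by positivity) (Real.quadratic_le_exp_of_nonneg hb)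
  have hkey : l * Real.exp (-(b * (1 - d))) ≤ l - d := by
    calc l * Real.exp (-(b * (1 - d)))
        ≤ l * ((1 - d) * (1 / (1 + b + b ^ 2 / 2)) + d) := by
          have := mul_le_mul_of_nonneg_left hexp (sub_nonneg.2 hd1)
          gcongr
          linarith
      _ = l - d := by
          rw [hd, deformedStep]
          have h1 : 1 + b + b ^ 2 / 2 ≠ 0 := by positivity
          field_simp
          ring
  have hsplit : Real.exp (-b) * Real.exp (b * l) =
      Real.exp (-(b * (1 - d))) * Real.exp (b * (l - d)) := by
    rw [← Real.exp_add, ← Real.exp_add]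
    ring_nf
  calc Real.exp (-b) * (l * Real.exp (b * l))
      = l * Real.exp (-(b * (1 - d))) * Real.exp (b * (l - d)) := by
        rw [mul_assoc l, ← hsplit]; ring
    _ ≤ _ := by gcongr

/-- The exponent of the supersolution, in the variable `l` with `x = l * exp (b * l)`. -/
noncomputable def deformedExponent (b l : ℝ) : ℝ := l + b * l ^ 2 / 2 + b ^ 2 * l ^ 2 / 4

lemma deformed_exponent_gap {b l : ℝ} (hb : 0 ≤ b) (hl : 0 ≤ l) :
    deformedExponent b (l - deformedStep b l) + b * l ≤
      deformedExponent b l + 2 * (b ^ 2 * l / (2 * (1 + b * l))) /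
        (b ^ 2 * l / (2 * (1 + b * l)) + 2) := by
  have hD : 0 < 1 + b + b ^ 2 / 2 + l * (b + b ^ 2 / 2) := by positivity
  have hpoly := gap_polynomial_nonneg hb hl
  set p := (1 - 3 / 2 * l + 2 * l ^ 2) + b * (1 - l / 2 + l ^ 2 / 2 + 2 * l ^ 3)
      + b ^ 2 * (1 / 2 - l / 2 - l ^ 2 / 4 + 5 / 2 * l ^ 3)
      + b ^ 3 * (-l / 4 + l ^ 2 / 8 + l ^ 3) + b ^ 4 * (l ^ 2 / 16 + l ^ 3 / 8) with hp
  have hlog : 2 * (b ^ 2 * l / (2 * (1 + b * l))) / (b ^ 2 * l / (2 * (1 + b * l)) + 2) =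
      2 * (b ^ 2 * l) / (b ^ 2 * l + 4 * (1 + b * l)) := by
    have : 1 + b * l ≠ 0 := by positivity
    field_simp
    ring
  have hnonneg : 0 ≤ b ^ 4 * l * p / ((1 + b + b ^ 2 / 2 + l * (b + b ^ 2 / 2)) ^ 2 *
      (b ^ 2 * l + 4 * (1 + b * l))) := by positivity
  have heq : deformedExponent b l + 2 * (b ^ 2 * l) / (b ^ 2 * l + 4 * (1 + b * l)) -
      (deformedExponent b (l - deformedStep b l) + b * l) =
      b ^ 4 * l * p / ((1 + b + b ^ 2 / 2 + l * (b + b ^ 2 / 2)) ^ 2 *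
      (b ^ 2 * l + 4 * (1 + b * l))) := by
    have h2 : b ^ 2 * l + 4 * (1 + b * l) ≠ 0 := by positivity
    rw [deformedExponent, deformedExponent, deformedStep, hp, eq_div_iff (by positivity)]
    generalize hDD : 1 + b + b ^ 2 / 2 + l * (b + b ^ 2 / 2) = D at *
    have h1 : D ≠ 0 := hD.ne'
    field_simp
    rw [← hDD]
    ring
  rw [hlog]
  linarith

/-- `exp (deformedExponent b l)` is a supersolution of the pantograph equation: its derivative
in `l` dominates its value at the dilated point times the derivative of `l * exp (b * l)`. -/
lemma exp_deformedExponent_supersolution {b l : ℝ} (hb : 0 ≤ b) (hl : 0 ≤ l) :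
    Real.exp (deformedExponent b (l - deformedStep b l)) * ((1 + b * l) * Real.exp (b * l)) ≤
      Real.exp (deformedExponent b l) * (1 + b * l + b ^ 2 * l / 2) := by
  have hz : 0 ≤ b ^ 2 * l / (2 * (1 + b * l)) := by positivity
  have hlog := Real.le_log_one_add_of_nonneg hz
  have hgap := deformed_exponent_gap hb hl
  have hfac : 1 + b * l + b ^ 2 * l / 2 =
      (1 + b * l) * (1 + b ^ 2 * l / (2 * (1 + b * l))) := by
    have : 1 + b * l ≠ 0 := by positivity
    field_simp
  calc Real.exp (deformedExponent b (l - deformedStep b l)) * ((1 + b * l) * Real.exp (b * l))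
      = (1 + b * l) * Real.exp (deformedExponent b (l - deformedStep b l) + b * l) := by
        rw [Real.exp_add]; ring
    _ ≤ (1 + b * l) * Real.exp (deformedExponent b l +
          Real.log (1 + b ^ 2 * l / (2 * (1 + b * l)))) := by
        refine mul_le_mul_of_nonneg_left (Real.exp_le_exp.2 ?_) (by positivity)
        linarith
    _ = _ := by
        rw [Real.exp_add, Real.exp_log (by positivity), hfac]
        ring

/-- Induction on the truncation: `deformedExpSum b N` at the dilated point is the derivative of
`deformedExpSum b (N + 1)`, so the bound for `N` and the supersolution property give the bound for
`N + 1` by monotonicity of the difference. -/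
lemma deformedExpSum_le_exp {b : ℝ} (hb : 0 ≤ b) (N : ℕ) : ∀ {l : ℝ}, 0 ≤ l →
    deformedExpSum b N (l * Real.exp (b * l)) ≤ Real.exp (deformedExponent b l) := by
  induction N with
  | zero => intro l _; simpa [deformedExpSum] using (Real.exp_pos _).le
  | succ N ih =>
    intro l hl
    have hderiv : ∀ t : ℝ, HasDerivAt
        (fun t ↦ Real.exp (deformedExponent b t) - deformedExpSum b (N + 1) (t * Real.exp (b * t)))
        (Real.exp (deformedExponent b t) * (1 + b * t + b ^ 2 * t / 2) -
          deformedExpSum b N (Real.exp (-b) * (t * Real.exp (b * t))) *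
            ((1 + b * t) * Real.exp (b * t))) t := by
      intro t
      have h1 : HasDerivAt (deformedExponent b) (1 + b * t + b ^ 2 * t / 2) t := by
        have := ((hasDerivAt_id t).add (((hasDerivAt_pow 2 t).const_mul b).div_const 2)).add
          (((hasDerivAt_pow 2 t).const_mul (b ^ 2)).div_const 4)
        convert! this using 1
        simp
        ring
      have h2 : HasDerivAt (fun t ↦ t * Real.exp (b * t)) ((1 + b * t) * Real.exp (b * t)) t := by
        have := (hasDerivAt_id t).mul (((hasDerivAt_id t).const_mul b).exp)
        convert! this using 1
        simp
        ring
      exact h1.exp.sub ((hasDerivAt_deformedExpSum b N _).comp t h2)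
    have hmono : MonotoneOn (fun t ↦ Real.exp (deformedExponent b t) -
        deformedExpSum b (N + 1) (t * Real.exp (b * t))) (Set.Ici 0) := by
      refine monotoneOn_of_deriv_nonneg (convex_Ici 0)
        (fun t _ ↦ (hderiv t).continuousAt.continuousWithinAt)
        (fun t _ ↦ (hderiv t).differentiableAt.differentiableWithinAt) fun t ht ↦ ?_
      rw [interior_Ici, Set.mem_Ioi] at ht
      rw [(hderiv t).deriv, sub_nonneg]
      refine le_trans ?_ (exp_deformedExponent_supersolution hb ht.le)
      gcongr
      exact (deformedExpSum_mono b N (by positivity)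
        (exp_neg_mul_le_of_deformedStep hb ht.le)).trans
          (ih (sub_nonneg.2 (deformedStep_le hb ht.le)))
    have h0 := hmono Set.self_mem_Ici (Set.mem_Ici.2 hl) hl
    simp only [zero_mul, deformedExpSum_zero_right] at h0
    simp only [deformedExponent, ne_eq, OfNat.ofNat_ne_zero, not_false_eq_true, zero_pow, mul_zero,
      zero_div, add_zero, Real.exp_zero, sub_self] at h0
    simpa [deformedExponent] using h0

/-! ### The Laplace transform of the second Poisson–Charlier polynomial -/

lemma poissonCharlier_two {lam : ℝ} (hlam : 0 < lam) (x : ℝ) :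
    poissonCharlier lam 2 x = (x ^ 2 - (2 * lam + 1) * x + lam ^ 2) / (√2 * lam) := by
  have hnorm : (lam ^ 2 * ((2 : ℕ)! : ℝ)) ^ (-(1 / 2) : ℝ) = (√2 * lam)⁻¹ := by
    rw [Real.rpow_neg (by positivity), ← Real.sqrt_eq_rpow, mul_comm, Nat.factorial_two,
      Real.sqrt_mul (by positivity), Real.sqrt_sq hlam.le, Nat.cast_ofNat]
  rw [poissonCharlier, hnorm, div_eq_inv_mul]
  simp [Finset.sum_range_succ, descPochhammer_succ_right]
  left
  ring

/-- On the negative half-line the Laplace transform of `poissonCharlier lam 2` under the Poisson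
distribution is at most that of a standard Gaussian. -/
lemma integral_exp_neg_mul_poissonCharlier_two_le {lam : NNReal} (hlam : 0 < lam) {s : ℝ}
    (hs : 0 ≤ s) :
    Integrable (fun n : ℕ ↦ Real.exp (-s * poissonCharlier lam 2 n)) (poissonMeasure lam) ∧
      ∫ n : ℕ, Real.exp (-s * poissonCharlier lam 2 n) ∂(poissonMeasure lam) ≤
        Real.exp (s ^ 2 / 2) := by
  have hl : (0 : ℝ) < lam := hlam
  set l : ℝ := (lam : ℝ)
  have h2 : √2 ^ 2 = (2 : ℝ) := Real.sq_sqrt (by norm_num)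
  have h2pos : 0 < √(2 : ℝ) := by positivity
  -- The rate `b` is chosen so that the quadratic part of the exponent becomes `b * n.choose 2`.
  obtain ⟨b, hb, hbs⟩ : ∃ b : ℝ, 0 ≤ b ∧ s = b * l / √2 :=
    ⟨√2 * s / l, by positivity, by field_simp⟩
  have hterm (n : ℕ) : Real.exp (-l) * l ^ n / (n ! : ℝ) *
      Real.exp (-s * poissonCharlier l 2 n) = Real.exp (-l - b * l ^ 2 / 2) *
        (Real.exp (-(b * (n.choose 2 : ℕ))) * (l * Real.exp (b * l)) ^ n / (n ! : ℝ)) := by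
    have hexp : Real.exp (-l) * Real.exp (-s * poissonCharlier l 2 n) =
        Real.exp (-l - b * l ^ 2 / 2) * Real.exp (-(b * (n.choose 2 : ℕ))) *
          Real.exp (b * l) ^ n := by
      rw [← Real.exp_nat_mul, ← Real.exp_add, ← Real.exp_add, ← Real.exp_add,
        poissonCharlier_two hl, Nat.cast_choose_two, hbs]
      congr 1
      field_simp
      rw [h2]
      ring
    rw [mul_pow]
    linear_combination (l ^ n / (n ! : ℝ)) * hexp
  have hnonneg (n : ℕ) : 0 ≤ Real.exp (-l) * l ^ n / (n ! : ℝ) *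
      Real.exp (-s * poissonCharlier l 2 n) := by positivity
  have hbound (N : ℕ) : ∑ n ∈ Finset.range N, Real.exp (-l) * l ^ n / (n ! : ℝ) *
      Real.exp (-s * poissonCharlier l 2 n) ≤ Real.exp (s ^ 2 / 2) := by
    simp_rw [hterm]
    rw [← Finset.mul_sum]
    calc Real.exp (-l - b * l ^ 2 / 2) * deformedExpSum b N (l * Real.exp (b * l))
        ≤ Real.exp (-l - b * l ^ 2 / 2) * Real.exp (deformedExponent b l) := by
          gcongr
          exact deformedExpSum_le_exp hb N hl.le
      _ = Real.exp (s ^ 2 / 2) := by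
          rw [← Real.exp_add, hbs, div_pow, h2, deformedExponent]
          ring_nf
  refine ⟨?_, ?_⟩
  · rw [integrable_poissonMeasure_iff]
    simpa only [Real.norm_eq_abs, Real.abs_exp] using summable_of_sum_range_le hnonneg hbound
  · rw [integral_poissonMeasure]
    exact Real.tsum_le_of_sum_range_le hnonneg hbound

/-! ### The variational lower bound for the divergence -/

/-- The easy half of the Donsker–Varadhan formula, from Gibbs' inequality for the tilted measure. -/
lemma integral_sub_log_integral_exp_le_toReal_klDiv {α : Type*} [MeasurableSpace α]
    {μ ν : Measure α} [IsProbabilityMeasure μ] [IsProbabilityMeasure ν] {f : α → ℝ}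
    (hμν : μ ≪ ν) (hllr : Integrable (llr μ ν) μ) (hfμ : Integrable f μ)
    (hfν : Integrable (fun x ↦ Real.exp (f x)) ν) :
    ∫ x, f x ∂μ - Real.log (∫ x, Real.exp (f x) ∂ν) ≤ (klDiv μ ν).toReal := by
  have := isProbabilityMeasure_tilted hfν
  have hgibbs := integral_llr_add_sub_measure_univ_nonneg
    (hμν.trans (absolutelyContinuous_tilted hfν)) (integrable_llr_tilted_right hμν hfμ hllr hfν)
  rw [integral_llr_tilted_right hμν hfμ hfν hllr] at hgibbs
  rw [toReal_klDiv_of_measure_eq hμν (by simp)]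
  simp only [probReal_univ] at hgibbs
  linarith


theorem mainTheorem1 {Ω : Type*} [MeasurableSpace Ω] (μ : MeasureTheory.Measure Ω)
    [MeasureTheory.IsProbabilityMeasure μ] (X : Ω → ℕ) (hX : Measurable X)
    (lam : NNReal) (hlam : 0 < lam)
    (hmoment : ∫ ω, poissonCharlier (lam : ℝ) 2 (X ω : ℝ) ∂μ ≤ 0) :
    ENNReal.ofReal ((∫ ω, poissonCharlier (lam : ℝ) 2 (X ω : ℝ) ∂μ) ^ 2 / 2) ≤
      InformationTheory.klDiv (μ.map X) (ProbabilityTheory.poissonMeasure lam) := by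
  by_cases hint : Integrable (fun ω ↦ poissonCharlier (lam : ℝ) 2 (X ω : ℝ)) μ
  swap
  -- Without a second moment the Bochner integral is zero and the bound is trivial.
  · simp [integral_undef hint]
  by_cases hkl : klDiv (μ.map X) (poissonMeasure lam) = ⊤
  · simp [hkl]
  have := Measure.isProbabilityMeasure_map (μ := μ) hX.aemeasurable
  obtain ⟨hac, hllr⟩ := klDiv_ne_top_iff.1 hkl
  set c := ∫ ω, poissonCharlier (lam : ℝ) 2 (X ω : ℝ) ∂μ with hc
  have hmap : ∫ n : ℕ, poissonCharlier (lam : ℝ) 2 n ∂(μ.map X) = c :=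
    integral_map hX.aemeasurable .of_discrete
  have hintmap : Integrable (fun n : ℕ ↦ poissonCharlier (lam : ℝ) 2 n) (μ.map X) :=
    (integrable_map_measure .of_discrete hX.aemeasurable).2 hint
  -- The tilt `t = c` maximizes `t * c - t ^ 2 / 2`; it is admissible because `c ≤ 0`.
  obtain ⟨hexp, hle⟩ := integral_exp_neg_mul_poissonCharlier_two_le hlam (neg_nonneg.2 hmoment)
  simp only [neg_neg] at hexp hle
  have hdv := integral_sub_log_integral_exp_le_toReal_klDiv hac hllr (hintmap.const_mul c) hexp
  have hlog := Real.log_le_log (integral_exp_pos hexp) hle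
  rw [Real.log_exp] at hlog
  rw [integral_const_mul, hmap] at hdv
  refine ENNReal.ofReal_le_of_le_toReal ?_
  nlinarith
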